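/- Let $F$ be a field of characteristic zero and let $L$ be a nonzero finite-dimensional (right) Leibniz algebra over $F$, i.e. a finite-dimensional $F$-vector space with a bilinear product satisfying $[x,[y,z]]=[[x,y],z]-[[x,z],y]$ for all $x,y,z\in L$. A Leibniz algebra $A$ is solvable if $A^{(n)}=0$ for some $n$, where $A^{(0)}=A$ and $A^{(k+1)}=[A^{(k)},A^{(k)}]$ (the span of all products of two elements of $A^{(k)}$). A subalgebra $C$ of $L$ is a subideal of $L$ if there is a chain of subalgebras $C=C_t\subseteq C_{t-1}\subseteq\dots\subseteq C_0=L$ with $C_i$ a two-sided ideal of $C_{i-1}$ for $1\le i\le t$. A subalgebra $B$ of $L$ is a weak c-ideal of $L$ if there is a subideal $C$ of $L$ such that $L=B+C$ and $B\cap C\subseteq B_L$, where $B_L$ is the largest two-sided ideal of $L$ contained in $B$. Then $L$ has a solvable maximal (proper) subalgebra that is a weak c-ideal of $L$ if and only if $L$ is solvable. -/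

import Mathlib

namespace Leibniz

/-- The right Leibniz identity `[x,[y,z]] = [[x,y],z] - [[x,z],y]`, for a (not necessarily
associative) ring whose product `x * y` is written for the bracket `[x,y]`. A Leibniz algebra over
a field `F` is such an `L` which is an `F`-module with `F`-bilinear product, that is, with the
classes `Module F L`, `IsScalarTower F L L` and `SMulCommClass F L L`. -/
class IsLeibniz (L : Type*) [NonUnitalNonAssocRing L] : Prop where
  leibniz : ∀ x y z : L, x * (y * z) = (x * y) * z - (x * z) * y

section Definitions

variable (F : Type*) {L : Type*} [Field F] [NonUnitalNonAssocRing L] [Module F L]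

/-- `[A,B]`: the subspace spanned by all products `[a,b]` with `a ∈ A` and `b ∈ B`. -/
def product (A B : Submodule F L) : Submodule F L :=
  Submodule.span F {z | ∃ a ∈ A, ∃ b ∈ B, a * b = z}

variable (L) in
/-- The derived series `L^(0) = L`, `L^(k+1) = [L^(k), L^(k)]`. -/
def derivedSeries : ℕ → Submodule F L
  | 0 => ⊤
  | k + 1 => product F (derivedSeries k) (derivedSeries k)

variable (L) in
/-- `L` is solvable if some term of its derived series is zero. -/
def IsSolvable : Prop := ∃ n : ℕ, derivedSeries F L n = ⊥

variable {F}

/-- `A` is a (two-sided) ideal of `B`, for subspaces `A`, `B` of `L`. -/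
def IsIdealOf (A B : Submodule F L) : Prop :=
  A ≤ B ∧ ∀ a ∈ A, ∀ b ∈ B, a * b ∈ A ∧ b * a ∈ A

/-- The core `B_L`: the sum of all ideals of `L` contained in `B`. It is the largest ideal of `L`
contained in `B`, see `isGreatest_core`. -/
def core (B : NonUnitalSubalgebra F L) : Submodule F L :=
  sSup {I : Submodule F L | IsIdealOf I ⊤ ∧ I ≤ B.toSubmodule}

theorem isGreatest_core (B : NonUnitalSubalgebra F L) :
    IsGreatest {I : Submodule F L | IsIdealOf I ⊤ ∧ I ≤ B.toSubmodule} (core B) := by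
  refine ⟨⟨⟨le_top, ?_⟩, sSup_le fun I hI => hI.2⟩, fun I hI => le_sSup hI⟩
  intro a ha b _
  unfold core at ha ⊢
  rw [sSup_eq_iSup'] at ha ⊢
  induction ha using Submodule.iSup_induction' with
  | mem I x hx =>
    exact ⟨Submodule.mem_iSup_of_mem I (I.2.1.2 x hx b trivial).1,
      Submodule.mem_iSup_of_mem I (I.2.1.2 x hx b trivial).2⟩
  | zero => simp
  | add x y _ _ hx hy =>
    rw [add_mul, mul_add]
    exact ⟨add_mem hx.1 hy.1, add_mem hx.2 hy.2⟩

variable [IsScalarTower F L L] [SMulCommClass F L L]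

/-- `B` is a subideal of `L`: there is a chain `B = c t ⊆ ⋯ ⊆ c 1 ⊆ c 0 = L` of subalgebras, each
an ideal of the preceding one. (Repeated terms of a chain may be deleted, so it does not matter
whether the inclusions are required to be strict.) -/
def IsSubideal (B : NonUnitalSubalgebra F L) : Prop :=
  ∃ (t : ℕ) (c : ℕ → NonUnitalSubalgebra F L), c 0 = ⊤ ∧ c t = B ∧
    ∀ i < t, IsIdealOf (c (i + 1)).toSubmodule (c i).toSubmodule

/-- `B` is a weak c-ideal of `L`: there is a subideal `C` of `L` with `L = B + C` and
`B ∩ C ⊆ B_L`. -/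
def IsWeakCIdeal (B : NonUnitalSubalgebra F L) : Prop :=
  ∃ C : NonUnitalSubalgebra F L, IsSubideal C ∧
    B.toSubmodule ⊔ C.toSubmodule = ⊤ ∧ B.toSubmodule ⊓ C.toSubmodule ≤ core B

end Definitions

end Leibniz

/-!
If `L` is solvable and nonzero, it is not perfect, so `[L, L]` lies in a hyperplane. A hyperplane
containing `[L, L]` is a solvable ideal and a maximal subalgebra, with `L` as the required subideal
supplement (`exists_isWeakCIdeal_of_isSolvable`).

Conversely, let `M` be a solvable maximal subalgebra with a subideal supplement `C` such that
`M ∩ C ⊆ M_L`, and let `R` be a maximal solvable ideal of `L`.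

* Each quotient of consecutive terms of the chain from `L` down to `C` is a quotient of a subalgebra
  of `M`, hence solvable, so `C` contains some term `L^(n)` of the derived series
  (`exists_derivedSeriesOf_le_of_isSubideal`).
* `R` contains the Leibniz kernel, which is an abelian ideal, and by maximality `L / R` is a Lie
  algebra with trivial solvable radical. In characteristic zero such a Lie algebra is perfect, by
  Cartan's criterion. Hence `L^(n) + R = L` for all `n` (`product_top_sup_eq_top_of_maximal`,
  `derivedSeriesOf_top_sup_eq_top`).

If `R ⊄ M`, then `L = M + R` is an extension of a solvable algebra by a solvable ideal. If `R ⊆ M`,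
then `M = (M ∩ L^(n)) + R` lies in its core, so `M` is a solvable ideal and `M = R`. Then `L / M` is
a Lie algebra without proper nonzero subalgebras, hence of dimension one, and `[L, L] ⊆ M`.
-/

namespace Leibniz

/-! ### Products of subspaces and derived series -/

section Products

variable {F L : Type*} [Field F] [NonUnitalNonAssocRing L] [Module F L]

theorem mul_mem_product {A B : Submodule F L} {a b : L} (ha : a ∈ A) (hb : b ∈ B) :
    a * b ∈ product F A B :=
  Submodule.subset_span ⟨a, ha, b, hb, rfl⟩

theorem product_le {A B C : Submodule F L} :
    product F A B ≤ C ↔ ∀ a ∈ A, ∀ b ∈ B, a * b ∈ C := by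
  refine ⟨fun h a ha b hb => h (mul_mem_product ha hb), fun h => Submodule.span_le.2 ?_⟩
  rintro _ ⟨a, ha, b, hb, rfl⟩
  exact h a ha b hb

theorem product_mono {A B C D : Submodule F L} (h : A ≤ C) (h' : B ≤ D) :
    product F A B ≤ product F C D :=
  product_le.2 fun _ ha _ hb => mul_mem_product (h ha) (h' hb)

theorem map_product {L' : Type*} [NonUnitalNonAssocRing L'] [Module F L'] (f : L →ₙₐ[F] L')
    (A B : Submodule F L) :
    (product F A B).map (f : L →ₗ[F] L') =
      product F (A.map (f : L →ₗ[F] L')) (B.map (f : L →ₗ[F] L')) := by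
  apply le_antisymm
  · rw [Submodule.map_le_iff_le_comap, product_le]
    intro a ha b hb
    have h := mul_mem_product (Submodule.mem_map_of_mem (f := (f : L →ₗ[F] L')) ha)
      (Submodule.mem_map_of_mem (f := (f : L →ₗ[F] L')) hb)
    simpa using h
  · rw [product_le]
    rintro _ ⟨a, ha, rfl⟩ _ ⟨b, hb, rfl⟩
    exact ⟨a * b, mul_mem_product ha hb, by simp⟩

variable (F) in
/-- The derived series of a subspace `A` of `L`, computed inside `L`: `A^(0) = A` and
`A^(k+1) = [A^(k), A^(k)]`. Working inside `L` allows the derived series of subalgebras, ideals and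
sums of these to be compared as subspaces of one space. -/
def derivedSeriesOf (A : Submodule F L) : ℕ → Submodule F L
  | 0 => A
  | k + 1 => product F (derivedSeriesOf A k) (derivedSeriesOf A k)

theorem derivedSeriesOf_top (k : ℕ) :
    derivedSeriesOf F (⊤ : Submodule F L) k = derivedSeries F L k := by
  induction k with
  | zero => rfl
  | succ k ih => rw [derivedSeriesOf, derivedSeries, ih]

theorem derivedSeriesOf_add (A : Submodule F L) (m k : ℕ) :
    derivedSeriesOf F A (m + k) = derivedSeriesOf F (derivedSeriesOf F A m) k := by
  induction k with
  | zero => rfl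
  | succ k ih => rw [← add_assoc, derivedSeriesOf, ih, derivedSeriesOf]

theorem derivedSeriesOf_mono {A B : Submodule F L} (h : A ≤ B) (k : ℕ) :
    derivedSeriesOf F A k ≤ derivedSeriesOf F B k := by
  induction k with
  | zero => exact h
  | succ k ih => exact product_mono ih ih

theorem derivedSeriesOf_le {A : Submodule F L} (hA : product F A A ≤ A) (k : ℕ) :
    derivedSeriesOf F A k ≤ A := by
  induction k with
  | zero => exact le_rfl
  | succ k ih => exact (product_mono ih ih).trans hA

/-- Solvability is closed under extensions. -/
theorem derivedSeriesOf_add_eq_bot {A B : Submodule F L} {m k : ℕ}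
    (h : derivedSeriesOf F A m ≤ B) (hB : derivedSeriesOf F B k = ⊥) :
    derivedSeriesOf F A (m + k) = ⊥ := by
  rw [derivedSeriesOf_add, ← le_bot_iff, ← hB]
  exact derivedSeriesOf_mono h k

theorem isSolvable_of_derivedSeriesOf_le {B : Submodule F L} {m : ℕ}
    (h : derivedSeriesOf F ⊤ m ≤ B) (hB : ∃ k, derivedSeriesOf F B k = ⊥) :
    IsSolvable F L := by
  obtain ⟨k, hk⟩ := hB
  exact ⟨m + k, by rw [← derivedSeriesOf_top, derivedSeriesOf_add_eq_bot h hk]⟩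

/-- The mixed products of `A + B` with itself lie in the ideal `B`. -/
theorem product_sup_le {A B K : Submodule F L} (hB : IsIdealOf B K) (hAK : A ≤ K) :
    product F (A ⊔ B) (A ⊔ B) ≤ product F A A ⊔ B := by
  refine product_le.2 fun x hx y hy => ?_
  obtain ⟨a, ha, b, hb, rfl⟩ := Submodule.mem_sup.1 hx
  obtain ⟨a', ha', b', hb', rfl⟩ := Submodule.mem_sup.1 hy
  rw [add_mul, mul_add, add_assoc]
  exact Submodule.add_mem_sup (mul_mem_product ha ha')
    (add_mem (hB.2 b' hb' a (hAK ha)).2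
      (hB.2 b hb _ (add_mem (hAK ha') (hB.1 hb'))).1)

/-- If `B` is an ideal of `K` and `A ⊆ K` is closed under the product, then modulo `B` the derived
series of `A + B` is that of `A`. -/
theorem derivedSeriesOf_sup_le {A B K : Submodule F L} (hA : product F A A ≤ A)
    (hB : IsIdealOf B K) (hAK : A ≤ K) (k : ℕ) :
    derivedSeriesOf F (A ⊔ B) k ≤ derivedSeriesOf F A k ⊔ B := by
  induction k with
  | zero => exact le_rfl
  | succ k ih =>
    exact (product_mono ih ih).trans
      (product_sup_le hB ((derivedSeriesOf_le hA k).trans hAK))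

/-- Perfectness modulo an ideal `R` passes to all terms of the derived series. -/
theorem derivedSeriesOf_top_sup_eq_top {R : Submodule F L} (hR : IsIdealOf R ⊤)
    (h : product F ⊤ ⊤ ⊔ R = ⊤) (n : ℕ) : derivedSeriesOf F ⊤ n ⊔ R = ⊤ := by
  induction n with
  | zero => exact top_sup_eq _
  | succ n ih =>
    rw [← top_le_iff]
    calc (⊤ : Submodule F L) = product F ⊤ ⊤ ⊔ R := h.symm
      _ = product F (derivedSeriesOf F ⊤ n ⊔ R) (derivedSeriesOf F ⊤ n ⊔ R) ⊔ R := by rw [ih]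
      _ ≤ derivedSeriesOf F ⊤ (n + 1) ⊔ R := sup_le (product_sup_le hR le_top) le_sup_right

theorem product_self_le (A : NonUnitalSubalgebra F L) :
    product F A.toSubmodule A.toSubmodule ≤ A.toSubmodule :=
  product_le.2 fun _ ha _ hb => A.mul_mem ha hb

theorem map_derivedSeries_subalgebra (A : NonUnitalSubalgebra F L) (k : ℕ) :
    (derivedSeries F A k).map
      (NonUnitalSubalgebraClass.subtype A : A →ₗ[F] L) =
      derivedSeriesOf F A.toSubmodule k := by
  induction k with
  | zero =>
    ext x
    simp [derivedSeries, derivedSeriesOf]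
  | succ k ih => rw [derivedSeries, derivedSeriesOf, map_product, ih]

theorem isSolvable_subalgebra_iff (A : NonUnitalSubalgebra F L) :
    IsSolvable F A ↔ ∃ k, derivedSeriesOf F A.toSubmodule k = ⊥ := by
  refine exists_congr fun k => ?_
  rw [← map_derivedSeries_subalgebra]
  exact ((Submodule.map_injective_of_injective Subtype.val_injective).eq_iff'
    (Submodule.map_bot _)).symm

end Products

/-! ### The Leibniz kernel and maximal solvable ideals -/

section Ideals

variable {F L : Type*} [Field F] [NonUnitalNonAssocRing L] [Module F L]

theorem isIdealOf_sup {A B K : Submodule F L} (hA : IsIdealOf A K) (hB : IsIdealOf B K) :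
    IsIdealOf (A ⊔ B) K := by
  refine ⟨sup_le hA.1 hB.1, fun x hx y hy => ?_⟩
  obtain ⟨a, ha, b, hb, rfl⟩ := Submodule.mem_sup.1 hx
  rw [add_mul, mul_add]
  exact ⟨Submodule.add_mem_sup (hA.2 a ha y hy).1 (hB.2 b hb y hy).1,
    Submodule.add_mem_sup (hA.2 a ha y hy).2 (hB.2 b hb y hy).2⟩

theorem isIdealOf_top_of_product_le {A : Submodule F L} (h : product F ⊤ ⊤ ≤ A) :
    IsIdealOf A ⊤ :=
  ⟨le_top, fun _ _ _ _ => ⟨h (mul_mem_product trivial trivial),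
    h (mul_mem_product trivial trivial)⟩⟩

variable (F L) in
/-- The Leibniz kernel: the span of all squares. It is an ideal, and the quotient by it is a Lie
algebra. -/
def leibnizKernel : Submodule F L := Submodule.span F (Set.range fun x : L => x * x)

theorem mul_self_mem_leibnizKernel (x : L) : x * x ∈ leibnizKernel F L :=
  Submodule.subset_span ⟨x, rfl⟩

/-- `L` has a maximal solvable ideal. (It is the solvable radical, but only maximality is used.) -/
theorem exists_maximal_solvable_ideal [FiniteDimensional F L] :
    ∃ R : Submodule F L,
      Maximal (fun I => IsIdealOf I ⊤ ∧ ∃ k, derivedSeriesOf F I k = ⊥) R := by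
  have hne : {I : Submodule F L | IsIdealOf I ⊤ ∧ ∃ k, derivedSeriesOf F I k = ⊥}.Nonempty := by
    refine ⟨⊥, ⟨bot_le, fun a ha b _ => ?_⟩, 0, rfl⟩
    rw [Submodule.mem_bot] at ha
    simp [ha]
  obtain ⟨R, hR, hmax⟩ := WellFounded.has_min (wellFounded_gt (α := Submodule F L)) _ hne
  exact ⟨R, hR, fun I hI hRI => by
    by_contra h
    exact hmax I hI (lt_of_le_not_ge hRI h)⟩

variable [SMulCommClass F L L]

theorem mul_eq_zero_of_mem_leibnizKernel [IsLeibniz L] (x : L) {y : L}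
    (hy : y ∈ leibnizKernel F L) : x * y = 0 := by
  have h : leibnizKernel F L ≤ LinearMap.ker (LinearMap.mulLeft F x) := by
    refine Submodule.span_le.2 ?_
    rintro _ ⟨z, rfl⟩
    simp [IsLeibniz.leibniz x z z]
  exact h hy

variable [IsScalarTower F L L]

theorem isIdealOf_leibnizKernel [IsLeibniz L] : IsIdealOf (leibnizKernel F L) ⊤ := by
  refine ⟨le_top, fun a ha b _ => ⟨?_, ?_⟩⟩
  · have h : leibnizKernel F L ≤ (leibnizKernel F L).comap (LinearMap.mulRight F b) := by
      refine Submodule.span_le.2 ?_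
      rintro _ ⟨x, rfl⟩
      -- The Leibniz identity turns `(x * x) * b` into a polarised square.
      have h1 : x * x * b = (x + x * b) * (x + x * b) - x * x - (x * b) * (x * b) := by
        have := IsLeibniz.leibniz x x b
        rw [eq_sub_iff_add_eq] at this
        rw [← this, add_mul, mul_add, mul_add]
        abel
      simp only [Submodule.comap_coe, Set.mem_preimage, LinearMap.mulRight_apply, SetLike.mem_coe]
      rw [h1]
      exact sub_mem (sub_mem (mul_self_mem_leibnizKernel _) (mul_self_mem_leibnizKernel _))
        (mul_self_mem_leibnizKernel _)
    exact h ha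
  · rw [mul_eq_zero_of_mem_leibnizKernel b ha]
    exact zero_mem _

/-- The Leibniz kernel is abelian, hence lies in every maximal solvable ideal. -/
theorem leibnizKernel_le_of_maximal [IsLeibniz L] {R : Submodule F L}
    (hR : Maximal (fun I => IsIdealOf I ⊤ ∧ ∃ k, derivedSeriesOf F I k = ⊥) R) :
    leibnizKernel F L ≤ R := by
  obtain ⟨⟨hRi, k, hk⟩, hmax⟩ := hR
  have hA : product F (leibnizKernel F L) (leibnizKernel F L) = ⊥ :=
    le_bot_iff.1 (product_le.2 fun a _ b hb => mul_eq_zero_of_mem_leibnizKernel a hb)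
  have h1 : derivedSeriesOf F (leibnizKernel F L ⊔ R) 1 ≤ R :=
    (product_sup_le hRi le_top).trans (by rw [hA, bot_sup_eq])
  exact le_sup_left.trans
    (hmax ⟨isIdealOf_sup isIdealOf_leibnizKernel hRi, 1 + k, derivedSeriesOf_add_eq_bot h1 hk⟩
      le_sup_right)

end Ideals

/-! ### Lie algebra quotients -/

section LieQuotient

variable {F L : Type*} [Field F] [NonUnitalNonAssocRing L] [Module F L]

/-- The Lie ring `L ⧸ R`, with bracket induced by the product of `L`, for an ideal `R` of `L`
that contains all squares. -/
@[reducible]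
def quotientLieRing [IsLeibniz L] {R : Submodule F L} (hR : IsIdealOf R ⊤)
    (hsq : ∀ x : L, x * x ∈ R) : LieRing (L ⧸ R) where
  bracket := Quotient.map₂ (· * ·) fun a a' ha b b' hb => by
    have ha := (Submodule.quotientRel_def R).1 ha
    have hb := (Submodule.quotientRel_def R).1 hb
    refine (Submodule.quotientRel_def R).2 ?_
    have h : a * b - a' * b' = (a - a') * b + a' * (b - b') := by
      rw [sub_mul, mul_sub]; abel
    rw [h]
    exact add_mem (hR.2 _ ha b trivial).1 (hR.2 _ hb a' trivial).2
  add_lie x y z := by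
    induction x using Submodule.Quotient.induction_on
    induction y using Submodule.Quotient.induction_on
    induction z using Submodule.Quotient.induction_on
    exact congrArg (Submodule.Quotient.mk (p := R)) (add_mul _ _ _)
  lie_add x y z := by
    induction x using Submodule.Quotient.induction_on
    induction y using Submodule.Quotient.induction_on
    induction z using Submodule.Quotient.induction_on
    exact congrArg (Submodule.Quotient.mk (p := R)) (mul_add _ _ _)
  lie_self x := by
    induction x using Submodule.Quotient.induction_on
    exact (Submodule.Quotient.mk_eq_zero R).2 (hsq _)
  leibniz_lie x y z := by
    induction x using Submodule.Quotient.induction_on with | _ x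
    induction y using Submodule.Quotient.induction_on with | _ y
    induction z using Submodule.Quotient.induction_on with | _ z
    refine (Submodule.Quotient.eq R (x := x * (y * z)) (y := x * y * z + y * (x * z))).2 ?_
    -- Modulo squares the product is alternating, so `(x * z) * y` and `-(y * (x * z))` agree.
    have h : x * (y * z) - (x * y * z + y * (x * z)) =
        y * y + (x * z) * (x * z) - (y + x * z) * (y + x * z) := by
      rw [IsLeibniz.leibniz, add_mul, mul_add, mul_add]
      abel
    rw [h]
    exact sub_mem (add_mem (hsq _) (hsq _)) (hsq _)

/-- The Lie algebra structure on `L ⧸ R` for the bracket of `quotientLieRing`. -/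
@[reducible]
def quotientLieAlgebra [IsLeibniz L] [SMulCommClass F L L] {R : Submodule F L}
    (hR : IsIdealOf R ⊤) (hsq : ∀ x : L, x * x ∈ R) :
    letI := quotientLieRing hR hsq
    LieAlgebra F (L ⧸ R) :=
  letI := quotientLieRing hR hsq
  { (inferInstance : Module F (L ⧸ R)) with
    lie_smul := fun t x y => by
      induction x using Submodule.Quotient.induction_on
      induction y using Submodule.Quotient.induction_on
      exact congrArg (Submodule.Quotient.mk (p := R)) (mul_smul_comm _ _ _) }

end LieQuotient

/-! ### Perfectness modulo a maximal solvable ideal -/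

/-- In characteristic zero a Lie algebra with trivial solvable radical is perfect: the orthogonal
complement of `[G, G]` for the Killing form, which is nondegenerate by Cartan's criterion, is an
abelian ideal. -/
theorem lie_top_top_eq_top_of_hasTrivialRadical (F G : Type*) [Field F] [CharZero F] [LieRing G]
    [LieAlgebra F G] [FiniteDimensional F G] [LieAlgebra.HasTrivialRadical F G] :
    ⁅(⊤ : LieIdeal F G), (⊤ : LieIdeal F G)⁆ = ⊤ := by
  set I : LieIdeal F G := ⁅(⊤ : LieIdeal F G), (⊤ : LieIdeal F G)⁆
  have hc := LieIdeal.isCompl_killingCompl I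
  have hJ : IsLieAbelian (LieIdeal.killingCompl F G I) := by
    rw [LieSubmodule.lie_abelian_iff_lie_self_eq_bot, ← le_bot_iff, ← hc.inf_eq_bot]
    exact le_inf (LieSubmodule.mono_lie le_top le_top) (LieSubmodule.lie_le_left _ _)
  have h0 := (LieAlgebra.hasTrivialRadical_iff_no_abelian_ideals F G).1 inferInstance _ hJ
  have := hc.sup_eq_top
  rwa [h0, sup_bot_eq] at this

section Perfect

variable {F L : Type*} [Field F] [NonUnitalNonAssocRing L] [Module F L]
  [IsScalarTower F L L] [SMulCommClass F L L]

/-- In characteristic zero `L` is perfect modulo a maximal solvable ideal. -/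
theorem product_top_sup_eq_top_of_maximal [CharZero F] [IsLeibniz L] [FiniteDimensional F L]
    {R : Submodule F L}
    (hR : Maximal (fun I => IsIdealOf I ⊤ ∧ ∃ k, derivedSeriesOf F I k = ⊥) R) :
    product F ⊤ ⊤ ⊔ R = ⊤ := by
  have hsq : ∀ x : L, x * x ∈ R := fun x =>
    leibnizKernel_le_of_maximal hR (mul_self_mem_leibnizKernel x)
  let := quotientLieRing hR.prop.1 hsq
  let := quotientLieAlgebra hR.prop.1 hsq
  have hmk (a b : L) : R.mkQ (a * b) = ⁅R.mkQ a, R.mkQ b⁆ := rfl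
  -- The preimage of a solvable ideal of `L ⧸ R` is a solvable ideal of `L` containing `R`.
  have : LieAlgebra.HasTrivialRadical F (L ⧸ R) := by
    refine LieAlgebra.hasTrivialRadical_of_no_solvable_ideals fun J hJ => ?_
    obtain ⟨k, hk⟩ := LieAlgebra.IsSolvable.solvable F J
    rw [LieIdeal.derivedSeries_eq_bot_iff] at hk
    have hle (n : ℕ) : derivedSeriesOf F (J.toSubmodule.comap R.mkQ) n ≤
        (LieAlgebra.derivedSeriesOfIdeal F (L ⧸ R) n J).toSubmodule.comap R.mkQ := by
      induction n with
      | zero => exact le_rfl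
      | succ n ih =>
        refine (product_mono ih ih).trans (product_le.2 fun a ha b hb => ?_)
        rw [Submodule.mem_comap, hmk, LieAlgebra.derivedSeriesOfIdeal_succ]
        exact LieSubmodule.lie_mem_lie ha hb
    have hkR := hle k
    rw [hk, LieSubmodule.bot_toSubmodule, Submodule.comap_bot, Submodule.ker_mkQ] at hkR
    obtain ⟨m, hm⟩ := hR.prop.2
    have hid : IsIdealOf (J.toSubmodule.comap R.mkQ) ⊤ :=
      ⟨le_top, fun a ha b _ =>
        ⟨lie_mem_left F (L ⧸ R) J _ (R.mkQ b) ha, lie_mem_right F (L ⧸ R) J (R.mkQ b) _ ha⟩⟩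
    have hJR := hR.2 ⟨hid, k + m, derivedSeriesOf_add_eq_bot hkR hm⟩ (R.le_comap_mkQ _)
    rw [LieSubmodule.eq_bot_iff]
    intro x hx
    obtain ⟨a, rfl⟩ := R.mkQ_surjective x
    exact (Submodule.Quotient.mk_eq_zero R).2 (hJR hx)
  have hperf := congrArg LieSubmodule.toSubmodule
    (lie_top_top_eq_top_of_hasTrivialRadical F (L ⧸ R))
  rw [LieSubmodule.lieIdeal_oper_eq_linear_span', LieSubmodule.top_toSubmodule] at hperf
  have hmap : (product F (⊤ : Submodule F L) ⊤).map R.mkQ = ⊤ := by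
    rw [eq_top_iff, ← hperf, Submodule.span_le]
    rintro _ ⟨x, -, y, -, rfl⟩
    obtain ⟨a, rfl⟩ := R.mkQ_surjective x
    obtain ⟨b, rfl⟩ := R.mkQ_surjective y
    exact ⟨a * b, mul_mem_product trivial trivial, hmk a b⟩
  have := Submodule.comap_map_mkQ R (product F (⊤ : Submodule F L) ⊤)
  rw [hmap, Submodule.comap_top] at this
  rw [sup_comm, ← this]

end Perfect

/-! ### Supplements of maximal subalgebras -/

section Supplements

variable {F L : Type*} [Field F] [NonUnitalNonAssocRing L] [Module F L]
  [IsScalarTower F L L] [SMulCommClass F L L]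

/-- A subideal with a solvable supplement contains a term of the derived series: along the chain
`c`, each `c i` equals `(M ∩ c i) + c (i + 1)`, so its quotient by `c (i + 1)` is solvable. -/
theorem exists_derivedSeriesOf_le_of_isSubideal {M C : NonUnitalSubalgebra F L}
    (hM : ∃ k, derivedSeriesOf F M.toSubmodule k = ⊥) (hC : IsSubideal C)
    (hMC : M.toSubmodule ⊔ C.toSubmodule = ⊤) :
    ∃ n, derivedSeriesOf F ⊤ n ≤ C.toSubmodule := by
  obtain ⟨k, hk⟩ := hM
  obtain ⟨t, c, h0, rfl, hid⟩ := hC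
  have hanti : ∀ j, j ≤ t → (c t).toSubmodule ≤ (c j).toSubmodule := by
    intro j hj
    induction hj using Nat.decreasingInduction with
    | self => exact le_rfl
    | of_succ i hi ih => exact ih.trans (hid i hi).1
  suffices h : ∀ i ≤ t, ∃ n, derivedSeriesOf F ⊤ n ≤ (c i).toSubmodule from h t le_rfl
  intro i
  induction i with
  | zero =>
    intro _
    exact ⟨0, by simp [h0]⟩
  | succ i ih =>
    intro hi
    obtain ⟨n, hn⟩ := ih (Nat.le_of_succ_le hi)
    refine ⟨n + k, ?_⟩
    have hsum : M.toSubmodule ⊓ (c i).toSubmodule ⊔ (c (i + 1)).toSubmodule =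
        (c i).toSubmodule := by
      rw [inf_comm, inf_sup_assoc_of_le _ (hid i hi).1, inf_eq_left]
      exact le_top.trans (hMC.ge.trans (sup_le_sup_left (hanti _ hi) _))
    have hle := derivedSeriesOf_sup_le (A := M.toSubmodule ⊓ (c i).toSubmodule)
      (product_self_le (M ⊓ c i)) (hid i hi) inf_le_right k
    rw [hsum, le_bot_iff.1 ((derivedSeriesOf_mono inf_le_left k).trans hk.le), bot_sup_eq] at hle
    rw [derivedSeriesOf_add]
    exact (derivedSeriesOf_mono hn k).trans hle

/-- A subspace closed under the product and strictly containing a maximal subalgebra is `L`. -/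
theorem eq_top_of_lt_of_isCoatom {M : NonUnitalSubalgebra F L} (hM : IsCoatom M)
    {A : Submodule F L} (hA : product F A A ≤ A) (hMA : M.toSubmodule < A) : A = ⊤ := by
  let A' : NonUnitalSubalgebra F L :=
    { A with mul_mem' := fun ha hb => hA (mul_mem_product ha hb) }
  have h : A' = ⊤ := hM.2 A' hMA
  exact congrArg NonUnitalSubalgebra.toSubmodule h

theorem isSolvable_of_isWeakCIdeal [CharZero F] [IsLeibniz L] [FiniteDimensional F L]
    {M : NonUnitalSubalgebra F L} (hmax : IsCoatom M) (hsol : IsSolvable F M)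
    (hwc : IsWeakCIdeal M) : IsSolvable F L := by
  rw [isSolvable_subalgebra_iff] at hsol
  obtain ⟨C, hC, hMC, hcore⟩ := hwc
  obtain ⟨R, hR⟩ := exists_maximal_solvable_ideal (F := F) (L := L)
  have hperf := product_top_sup_eq_top_of_maximal hR
  by_cases hRM : R ≤ M.toSubmodule
  · obtain ⟨n, hn⟩ := exists_derivedSeriesOf_le_of_isSubideal hsol hC hMC
    -- By the modular law `M = (M ∩ L^(n)) + R`, and both summands lie in the core of `M`.
    have hMeq : M.toSubmodule = core M := by
      refine le_antisymm ?_ (isGreatest_core M).1.2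
      calc M.toSubmodule
          = M.toSubmodule ⊓ (derivedSeriesOf F ⊤ n ⊔ R) := by
            rw [derivedSeriesOf_top_sup_eq_top hR.prop.1 hperf, inf_top_eq]
        _ = M.toSubmodule ⊓ derivedSeriesOf F ⊤ n ⊔ R := (inf_sup_assoc_of_le _ hRM).symm
        _ ≤ core M := sup_le ((inf_le_inf_left _ hn).trans hcore)
            ((isGreatest_core M).2 ⟨hR.prop.1, hRM⟩)
    have hMid : IsIdealOf M.toSubmodule ⊤ := hMeq ▸ (isGreatest_core M).1.1
    have hMR : M.toSubmodule = R := le_antisymm (hR.2 ⟨hMid, hsol⟩ hRM) hRM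
    obtain ⟨x, hx⟩ : ∃ x, x ∉ M.toSubmodule := by
      by_contra! h
      exact hmax.1 (eq_top_iff.2 fun x _ => h x)
    -- Squares lie in `R = M`, so `F x + M` is a subalgebra, and its products lie in `M`.
    have hxx : product F (F ∙ x) (F ∙ x) ≤ M.toSubmodule := by
      refine product_le.2 fun a ha b hb => ?_
      obtain ⟨s, rfl⟩ := Submodule.mem_span_singleton.1 ha
      obtain ⟨t, rfl⟩ := Submodule.mem_span_singleton.1 hb
      rw [smul_mul_smul_comm, hMR]
      exact R.smul_mem _ (leibnizKernel_le_of_maximal hR (mul_self_mem_leibnizKernel x))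
    have hprod : product F ((F ∙ x) ⊔ M.toSubmodule) ((F ∙ x) ⊔ M.toSubmodule) ≤
        M.toSubmodule :=
      (product_sup_le hMid le_top).trans (sup_le hxx le_rfl)
    have htop := eq_top_of_lt_of_isCoatom hmax (hprod.trans le_sup_right)
      (lt_of_le_of_ne le_sup_right fun h =>
        hx (h ▸ Submodule.mem_sup_left (Submodule.mem_span_singleton_self x)))
    rw [htop] at hprod
    exact isSolvable_of_derivedSeriesOf_le (m := 1) hprod hsol
  · obtain ⟨k, hk⟩ := hsol
    have htop := eq_top_of_lt_of_isCoatom hmax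
      ((product_sup_le hR.prop.1 le_top).trans (sup_le_sup_right (product_self_le M) R))
      (left_lt_sup.2 hRM)
    have hle := derivedSeriesOf_sup_le (product_self_le M) hR.prop.1 le_top k
    rw [htop, hk, bot_sup_eq] at hle
    exact isSolvable_of_derivedSeriesOf_le hle hR.prop.2

/-- A nonzero solvable algebra is not perfect, so it has a hyperplane containing `[L, L]`. Such a
hyperplane is an ideal and a maximal subalgebra, and `L` itself serves as its supplement. -/
theorem exists_isWeakCIdeal_of_isSolvable [Nontrivial L] (h : IsSolvable F L) :
    ∃ M : NonUnitalSubalgebra F L, IsCoatom M ∧ IsSolvable F M ∧ IsWeakCIdeal M := by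
  obtain ⟨n, hn⟩ := h
  rw [← derivedSeriesOf_top] at hn
  have hne : product F (⊤ : Submodule F L) ⊤ ≠ ⊤ := by
    intro hp
    have htop : ∀ k, derivedSeriesOf F (⊤ : Submodule F L) k = ⊤ := by
      intro k
      induction k with
      | zero => rfl
      | succ k ih => rw [derivedSeriesOf, ih, hp]
    exact bot_ne_top (hn.symm.trans (htop n))
  obtain ⟨H, hH, hle⟩ := (eq_top_or_exists_le_coatom _).resolve_left hne
  let M : NonUnitalSubalgebra F L :=
    { H with mul_mem' := fun _ _ => hle (mul_mem_product trivial trivial) }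
  have hid : IsIdealOf M.toSubmodule ⊤ := isIdealOf_top_of_product_le hle
  refine ⟨M, ⟨fun hM => hH.1 (congrArg NonUnitalSubalgebra.toSubmodule hM), fun A hA => ?_⟩,
    (isSolvable_subalgebra_iff M).2 ⟨n, le_bot_iff.1 ((derivedSeriesOf_mono le_top n).trans hn.le)⟩,
    ⊤, ⟨0, fun _ => ⊤, rfl, rfl, fun i hi => absurd hi (Nat.not_lt_zero i)⟩, ?_, ?_⟩
  · exact NonUnitalSubalgebra.toSubmodule_injective (hH.2 A.toSubmodule hA)
  · simp
  · exact inf_le_left.trans ((isGreatest_core M).2 ⟨hid, le_rfl⟩)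

end Supplements

end Leibniz

theorem theorem3p4 {F L : Type*} [Field F] [CharZero F]
    [NonUnitalNonAssocRing L] [Module F L] [IsScalarTower F L L] [SMulCommClass F L L]
    [Leibniz.IsLeibniz L] [FiniteDimensional F L] [Nontrivial L] :
    (∃ M : NonUnitalSubalgebra F L,
        IsCoatom M ∧ Leibniz.IsSolvable F M ∧ Leibniz.IsWeakCIdeal M) ↔
      Leibniz.IsSolvable F L :=
  ⟨fun ⟨_, hmax, hsol, hwc⟩ => Leibniz.isSolvable_of_isWeakCIdeal hmax hsol hwc,
    Leibniz.exists_isWeakCIdeal_of_isSolvable⟩
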